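/- Let $k\in\{2,3,4\}$ and let $a\in\mathbb{F}_{2^k}\setminus\{0,1\}$. Let $\mathbf{u}=(u_n)_{n\ge 0}$ be the $(a,1)$-Thue–Morse sequence, i.e. the fixed point $s^\infty(a)$ of the substitution $s: a\mapsto a1,\ 1\mapsto 1a$. Let $$\mathrm{Stiel}(x;\mathbf{u})=\cfrac{u_0}{1+\cfrac{u_1x}{1+\cfrac{u_2x}{1+\cfrac{u_3x}{\ddots}}}}\in\mathbb{F}_{2^k}[[x]]$$ be its Stieltjes continued fraction, i.e. the limit in $\mathbb{F}_{2^k}[[x]]$ of the finite fractions $$\mathrm{Stiel}_n(x;\mathbf{u})=\cfrac{u_0}{1+\cfrac{u_1x}{1+\cfrac{\ddots}{1+u_nx}}}.$$ Then $\mathrm{Stiel}(x;\mathbf{u})$ is algebraic over $\mathbb{F}_{2^k}(x)$, and, up to normalization by the nonzero leading coefficient $p_4(x)$, its minimal polynomial over $\mathbb{F}_{2^k}(x)$ is $$p_0(x)+p_1(x)y+p_2(x)y^2+p_4(x)y^4,$$ where $$p_0(x)=\frac{a^2+1}{a^4}x^2+\frac{1}{a^5+a^4},\quad p_1(x)=\frac{a+1}{a^5}x+\frac{1}{a^5},\quad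 p_2(x)=\frac{1}{a^5}x+\frac{1}{a^6+a^5},\quad p_4(x)=\frac{1}{a^6+a^5}x^2.$$ -/

import Mathlib

open scoped Polynomial PowerSeries LaurentSeries RatFunc

/-- The substitution `s : a ↦ ab, b ↦ ba` on the letters `a`, `b`. -/
def thueMorseLetter {α : Type*} [DecidableEq α] (a b c : α) : List α :=
  if c = a then [a, b] else [b, a]

/-- The word `s^n(a)`. -/
def thueMorseWord {α : Type*} [DecidableEq α] (a b : α) : ℕ → List α
  | 0 => [a]
  | n + 1 => (thueMorseWord a b n).flatMap (thueMorseLetter a b)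

/-- The `(a, b)`-Thue–Morse sequence `s^∞(a)`: its `n`-th letter is the letter at position `n`
of the word `s^n(a)`, which has length `2 ^ n > n`. -/
def thueMorse {α : Type*} [DecidableEq α] (a b : α) (n : ℕ) : α :=
  (thueMorseWord a b n).getD n a

theorem thueMorseWord_length {α : Type*} [DecidableEq α] (a b : α) (n : ℕ) :
    (thueMorseWord a b n).length = 2 ^ n := by
  induction n with
  | zero => rfl
  | succ n ih =>
    have h : ∀ w : List α, (w.flatMap (thueMorseLetter a b)).length = 2 * w.length := by
      intro w
      induction w with
      | nil => rfl
      | cons c w ihw =>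
        have hc : (thueMorseLetter a b c).length = 2 := by
          unfold thueMorseLetter; split <;> rfl
        simp only [List.flatMap_cons, List.length_append, List.length_cons, hc, ihw]
        ring
    simp only [thueMorseWord, h, ih, pow_succ]
    ring

theorem thueMorseWord_prefix_succ {α : Type*} [DecidableEq α] (a b : α) (n : ℕ) :
    thueMorseWord a b n <+: thueMorseWord a b (n + 1) := by
  induction n with
  | zero => exact ⟨[b], by simp [thueMorseWord, thueMorseLetter]⟩
  | succ n ih =>
    obtain ⟨v, hv⟩ := ih
    refine ⟨v.flatMap (thueMorseLetter a b), ?_⟩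
    change (thueMorseWord a b n).flatMap _ ++ _ = (thueMorseWord a b (n + 1)).flatMap _
    rw [← hv, List.flatMap_append]

theorem thueMorseWord_prefix {α : Type*} [DecidableEq α] (a b : α) {m n : ℕ} (h : m ≤ n) :
    thueMorseWord a b m <+: thueMorseWord a b n := by
  induction n, h using Nat.le_induction with
  | base => exact List.prefix_refl _
  | succ n _ ih => exact ih.trans (thueMorseWord_prefix_succ a b n)

/-- Every word `s^n(a)` is a prefix of the Thue–Morse sequence. -/
theorem thueMorseWord_getElem? {α : Type*} [DecidableEq α] (a b : α) (n i : ℕ) (hi : i < 2 ^ n) :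
    (thueMorseWord a b n)[i]? = some (thueMorse a b i) := by
  have h1 : i < (thueMorseWord a b n).length := by rwa [thueMorseWord_length]
  have h2 : i < (thueMorseWord a b i).length := by
    rw [thueMorseWord_length]; exact Nat.lt_two_pow_self
  have key : (thueMorseWord a b n)[i]? = (thueMorseWord a b i)[i]? := by
    rcases le_total n i with h | h
    · obtain ⟨v, hv⟩ := thueMorseWord_prefix a b h
      rw [← hv, List.getElem?_append_left h1]
    · obtain ⟨v, hv⟩ := thueMorseWord_prefix a b h
      rw [← hv, List.getElem?_append_left h2]
  rw [key, thueMorse, List.getD_eq_getElem?_getD, List.getElem?_eq_getElem h2]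
  rfl

/-- The denominator `1 + u_j x / (1 + u_{j+1} x / (⋯ / (1 + u_{j+m-1} x)))`
with `m` partial numerators, starting at index `j`. -/
noncomputable def stieltjesDenom {K : Type*} [Field K] (u : ℕ → K) : ℕ → ℕ → K⟦X⟧
  | 0, _ => 1
  | m + 1, j => 1 + PowerSeries.C (u j) * PowerSeries.X * (stieltjesDenom u m (j + 1))⁻¹

/-- The finite Stieltjes continued fraction
`Stiel_n(x; u) = u_0 / (1 + u_1 x / (1 + u_2 x / (⋯ / (1 + u_n x))))`. -/
noncomputable def stieltjesFinite {K : Type*} [Field K] (u : ℕ → K) (n : ℕ) : K⟦X⟧ :=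
  PowerSeries.C (u 0) * (stieltjesDenom u n 1)⁻¹

/-- The Stieltjes continued fraction `Stiel(x; u)`: the limit in `K⟦X⟧` of the finite ones.
The coefficient of `x^d` is constant along `Stiel_n(x; u)` for `n ≥ d`
(`coeff_stieltjesFinite`), so this is the limit (`tendsto_stieltjesFinite`). -/
noncomputable def stieltjes {K : Type*} [Field K] (u : ℕ → K) : K⟦X⟧ :=
  PowerSeries.mk fun d => PowerSeries.coeff d (stieltjesFinite u d)

/-- All denominators have constant term `1`, hence are invertible power series. -/
theorem constantCoeff_stieltjesDenom {K : Type*} [Field K] (u : ℕ → K) (m j : ℕ) :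
    PowerSeries.constantCoeff (stieltjesDenom u m j) = 1 := by
  cases m <;> simp [stieltjesDenom]

theorem X_pow_dvd_inv_sub_inv {K : Type*} [Field K] {f g : K⟦X⟧} {n : ℕ}
    (hf : PowerSeries.constantCoeff f = 1) (hg : PowerSeries.constantCoeff g = 1)
    (h : PowerSeries.X ^ n ∣ f - g) : PowerSeries.X ^ n ∣ f⁻¹ - g⁻¹ := by
  have hf' : f⁻¹ * f = 1 := PowerSeries.inv_mul_cancel f (by simp [hf])
  have hg' : g⁻¹ * g = 1 := PowerSeries.inv_mul_cancel g (by simp [hg])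
  have e : f⁻¹ - g⁻¹ = (f - g) * (-(f⁻¹ * g⁻¹)) := by
    linear_combination g⁻¹ * hf' - f⁻¹ * hg'
  rw [e]
  exact Dvd.dvd.mul_right h _

theorem X_pow_dvd_stieltjesDenom_succ_sub {K : Type*} [Field K] (u : ℕ → K) (m j : ℕ) :
    (PowerSeries.X : K⟦X⟧) ^ (m + 1) ∣ stieltjesDenom u (m + 1) j - stieltjesDenom u m j := by
  induction m generalizing j with
  | zero => exact ⟨PowerSeries.C (u j), by simp [stieltjesDenom]; ring⟩
  | succ m ih =>
    obtain ⟨v, hv⟩ := X_pow_dvd_inv_sub_inv (constantCoeff_stieltjesDenom u (m + 1) (j + 1))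
      (constantCoeff_stieltjesDenom u m (j + 1)) (ih (j + 1))
    refine ⟨PowerSeries.C (u j) * v, ?_⟩
    have e1 : stieltjesDenom u (m + 1 + 1) j = 1 + PowerSeries.C (u j) * PowerSeries.X *
      (stieltjesDenom u (m + 1) (j + 1))⁻¹ := rfl
    have e2 : stieltjesDenom u (m + 1) j = 1 + PowerSeries.C (u j) * PowerSeries.X *
      (stieltjesDenom u m (j + 1))⁻¹ := rfl
    rw [e1, e2]
    linear_combination (PowerSeries.C (u j) * PowerSeries.X) * hv

theorem coeff_stieltjesFinite {K : Type*} [Field K] (u : ℕ → K) {d n : ℕ} (h : d ≤ n) :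
    PowerSeries.coeff d (stieltjesFinite u n) = PowerSeries.coeff d (stieltjes u) := by
  induction n, h using Nat.le_induction with
  | base => simp [stieltjes]
  | succ n hn ih =>
    rw [← ih, ← sub_eq_zero, ← map_sub]
    have h1 := X_pow_dvd_inv_sub_inv (constantCoeff_stieltjesDenom u (n + 1) 1)
      (constantCoeff_stieltjesDenom u n 1) (X_pow_dvd_stieltjesDenom_succ_sub u n 1)
    have h2 : (PowerSeries.X : K⟦X⟧) ^ (n + 1) ∣
        stieltjesFinite u (n + 1) - stieltjesFinite u n := by
      rw [stieltjesFinite, stieltjesFinite, ← mul_sub]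
      exact Dvd.dvd.mul_left h1 _
    exact PowerSeries.X_pow_dvd_iff.mp h2 d (by omega)

open scoped PowerSeries.WithPiTopology in
/-- `Stiel(x; u)` is the limit of `Stiel_n(x; u)` in `K⟦X⟧`, where `K` is discrete. -/
theorem tendsto_stieltjesFinite {K : Type*} [Field K] [TopologicalSpace K] [DiscreteTopology K]
    (u : ℕ → K) :
    Filter.Tendsto (stieltjesFinite u) Filter.atTop (nhds (stieltjes u)) := by
  rw [PowerSeries.WithPiTopology.tendsto_iff_coeff_tendsto]
  intro d
  refine tendsto_const_nhds.congr' ?_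
  filter_upwards [Filter.eventually_ge_atTop d] with n hn
  exact (coeff_stieltjesFinite u hn).symm

/-- The quartic polynomial `p_0(x) + p_1(x) y + p_2(x) y^2 + p_4(x) y^4` in `y`
over the field of rational functions `K(x)`. -/
noncomputable def quarticPoly {K : Type*} [Field K] (p0 p1 p2 p4 : RatFunc K) : (RatFunc K)[X] :=
  Polynomial.C p0 + Polynomial.C p1 * Polynomial.X + Polynomial.C p2 * Polynomial.X ^ 2 +
    Polynomial.C p4 * Polynomial.X ^ 4

/-! With `H = x(S + a)`, `t = 1 + (a+1)x`, `d = ax²`, the claim is a quartic equation for `H` plus a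
degree bound.

Equation: convergents are read off matrix products along `s^n(a)`. In characteristic two the
products at odd levels keep one shape (`exists_substMatrix_eq`), governed by the iteration `g ↦
t⁻²g⁴ + d`. Up to sign, the determinant is a square times `t⁻²g⁴ + g + d`, which tends to 0, so in
the limit `g⁴ = t²(g + d)` and `H = g + g²/t`. Eliminating `g` gives the quartic
(`quartic_relation_stieltjes_thueMorse`).

Degree: `w = g²/t` is a rational expression in `S` with `w⁴ + tw + d² = 0`. A constant shift makes
this Eisenstein at the linear prime `t` (`natDegree_minpoly_eq_four`), so `w`, and hence `S`, has
degree at least 4. -/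

/-! ### Transfer matrices along the substitution. -/

/-- The matrix of the Möbius map `z ↦ 1 + v / z`. -/
def stepMatrix {R : Type*} [CommRing R] (v : R) : Matrix (Fin 2) (Fin 2) R := !![1, v; 1, 0]

/-- The product of the matrices `φ` along the `n`-fold substituted letter `c`. -/
def substMatrix {R : Type*} [CommRing R] {α : Type*} [DecidableEq α] (a b : α) (φ : α → Matrix (Fin 2) (Fin 2) R) :
    ℕ → α → Matrix (Fin 2) (Fin 2) R
  | 0 => φ
  | n + 1 => fun c => ((thueMorseLetter a b c).map (substMatrix a b φ n)).prod

theorem substMatrix_succ_left {R : Type*} [CommRing R] {α : Type*} [DecidableEq α] (a b : α)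
    (φ : α → Matrix (Fin 2) (Fin 2) R) (n : ℕ) :
    substMatrix a b φ (n + 1) a = substMatrix a b φ n a * substMatrix a b φ n b := by
  simp [substMatrix, thueMorseLetter]

theorem substMatrix_succ_right {R : Type*} [CommRing R] {α : Type*} [DecidableEq α] {a b : α} (hab : b ≠ a)
    (φ : α → Matrix (Fin 2) (Fin 2) R) (n : ℕ) :
    substMatrix a b φ (n + 1) b = substMatrix a b φ n b * substMatrix a b φ n a := by
  simp [substMatrix, thueMorseLetter, hab]

/-- One substitution can be moved from the word into the letter matrices. The application has `k =
0`; general `k` serves the induction. -/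
theorem prod_map_thueMorseWord {R : Type*} [CommRing R] {α : Type*} [DecidableEq α] (a b : α)
    (φ : α → Matrix (Fin 2) (Fin 2) R) (n k : ℕ) :
    ((thueMorseWord a b n).map (substMatrix a b φ k)).prod = substMatrix a b φ (n + k) a := by
  induction n generalizing k with
  | zero => simp [thueMorseWord]
  | succ n ih =>
    have h : ∀ w : List α, ((w.flatMap (thueMorseLetter a b)).map (substMatrix a b φ k)).prod =
        (w.map (substMatrix a b φ (k + 1))).prod := by
      intro w
      induction w with
      | nil => rfl
      | cons c w ihw =>
        rw [List.flatMap_cons, List.map_append, List.prod_append, ihw, List.map_cons,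
          List.prod_cons]
        rfl
    rw [thueMorseWord, h, ih, add_right_comm, add_assoc]

theorem fin_two_matrix_congr {R : Type*} {a b c d a' b' c' d' : R} (ha : a = a') (hb : b = b') (hc : c = c')
    (hd : d = d') : !![a, b; c, d] = !![a', b'; c', d'] := by
  rw [ha, hb, hc, hd]

/-- In characteristic two the transfer matrices along `s^(2m+1)(a)` and `s^(2m+1)(1)` have a closed
form in terms of approximations `g` to a root of `g ^ 4 = t ^ 2 * (g + a * x ^ 2)`, where
`t = 1 + (a + 1) * x` has inverse `τ`. -/
theorem exists_substMatrix_eq {R : Type*} [CommRing R] {α : Type*} [DecidableEq α] {l₁ l₂ : α} (hl : l₂ ≠ l₁)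
    (h2 : (2 : R) = 0) {a x t τ : R} (ht : t = 1 + (a + 1) * x) (hτ : t * τ = 1)
    (φ : α → Matrix (Fin 2) (Fin 2) R) (hφ₁ : φ l₁ = stepMatrix (a * x))
    (hφ₂ : φ l₂ = stepMatrix x) (m : ℕ) :
    ∃ r p s g : R, IsUnit s ∧
      substMatrix l₁ l₂ φ (2 * m + 1) l₁ = !![r, p; s, r + t * s] ∧
      substMatrix l₁ l₂ φ (2 * m + 1) l₂ =
        !![r + t * s + s, p + (a + 1) * x * s; s, r + s] ∧
      r = s * (1 + a * x + g + τ * g ^ 2) ∧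
      r * (r + t * s) + p * s = s ^ 2 * (τ ^ 2 * g ^ 4 + g + a * x ^ 2) ∧
      x ^ (m + 1) ∣ τ ^ 2 * g ^ 4 + g + a * x ^ 2 := by
  have hu : IsUnit t := IsUnit.of_mul_eq_one τ hτ
  induction m with
  | zero =>
    refine ⟨1 + a * x, x, 1, 0, isUnit_one, ?_, ?_, ?_, ?_, ?_⟩
    · rw [substMatrix_succ_left]
      simp only [substMatrix, hφ₁, hφ₂, stepMatrix, Matrix.mul_fin_two]
      apply fin_two_matrix_congr <;> grind
    · rw [substMatrix_succ_right hl]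
      simp only [substMatrix, hφ₁, hφ₂, stepMatrix, Matrix.mul_fin_two]
      apply fin_two_matrix_congr <;> grind
    · ring
    · grind
    · exact ⟨a * x, by ring⟩
  | succ m ih =>
    obtain ⟨r, p, s, g, hs, hA, hB, hr, hdet, hx⟩ := ih
    have hc : (a + 1) * x = t - 1 := by rw [ht]; ring
    rw [hc] at hB
    obtain ⟨δ, hδ⟩ : ∃ δ, δ = τ ^ 2 * g ^ 4 + g + a * x ^ 2 := ⟨_, rfl⟩
    rw [← hδ] at hdet hx
    -- Fourth powers are additive in characteristic two, so replacing `g` by `g + δ = τ²g⁴ + ax²`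
    -- turns the error `δ` into `τ²δ⁴`.
    have hδ' : τ ^ 2 * (g + δ) ^ 4 + (g + δ) + a * x ^ 2 = τ ^ 2 * δ ^ 4 := by
      clear * - h2 hδ
      grind
    -- The even level has a different shape; `s²δ` is the determinant, substituted for `r(r + ts) +
    -- ps`.
    have hA' : substMatrix l₁ l₂ φ (2 * m + 1 + 1) l₁ =
        !![s * r + s ^ 2 * δ, s * ((t + 1) * r + p); s ^ 2, s * (r + s) + s ^ 2 * δ] := by
      rw [substMatrix_succ_left, hA, hB, Matrix.mul_fin_two]
      clear * - h2 hdet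
      apply fin_two_matrix_congr <;> grind
    have hB' : substMatrix l₁ l₂ φ (2 * m + 1 + 1) l₂ =
        !![s * (r + (t + 1) * s) + s ^ 2 * δ, s * (p + (t + 1) * (r + t * s));
          s ^ 2, s * (r + t * s) + s ^ 2 * δ] := by
      rw [substMatrix_succ_right hl, hA, hB, Matrix.mul_fin_two]
      clear * - h2 hdet
      apply fin_two_matrix_congr <;> grind
    have hr' : t * s ^ 3 * r + t * s ^ 2 * (s ^ 2 * δ) + (s ^ 2 * δ) ^ 2 =
        t * s ^ 4 * (1 + a * x + (g + δ) + τ * (g + δ) ^ 2) := by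
      linear_combination t * s ^ 3 * hr - s ^ 4 * δ ^ 2 * hτ - t * s ^ 4 * τ * g * δ * h2
    refine ⟨t * s ^ 3 * r + t * s ^ 2 * (s ^ 2 * δ) + (s ^ 2 * δ) ^ 2,
      t * s ^ 3 * p + t * s ^ 2 * (s ^ 2 * δ) * (t + 1), t * s ^ 4, g + δ, hu.mul (hs.pow 4),
      ?_, ?_, hr', ?_, ?_⟩
    · rw [show 2 * (m + 1) + 1 = 2 * m + 1 + 1 + 1 by ring, substMatrix_succ_left, hA', hB',
        Matrix.mul_fin_two]
      clear * - h2 hdet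
      apply fin_two_matrix_congr <;> grind
    · rw [show 2 * (m + 1) + 1 = 2 * m + 1 + 1 + 1 by ring, substMatrix_succ_right hl, hA', hB',
        Matrix.mul_fin_two, hc]
      clear * - h2 hdet
      apply fin_two_matrix_congr <;> grind
    · rw [hδ']
      have e : (t * s ^ 4) ^ 2 * (τ ^ 2 * δ ^ 4) = (s ^ 2 * δ) ^ 4 := by
        linear_combination (s ^ 8 * δ ^ 4 * (t * τ + 1)) * hτ
      rw [e]
      clear * - h2 hdet
      grind
    · rw [hδ']
      obtain ⟨v, hv⟩ := hx
      refine ⟨τ ^ 2 * v ^ 4 * x ^ (3 * m + 2), ?_⟩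
      rw [hv]
      ring

/-! ### Convergents and the quartic relation over power series. -/

section Convergents

variable {K : Type*} [Field K]

/-- The denominators of a Stieltjes continued fraction are quotients of entries of products of
step matrices. -/
theorem stieltjesDenom_eq_prod_stepMatrix (u : ℕ → K) (n j : ℕ) :
    ∃ p q r s : K⟦X⟧,
      ((List.range n).map fun i => stepMatrix (PowerSeries.C (u (j + i)) * PowerSeries.X)).prod =
        !![p, q; r, s] ∧
      p + q = (r + s) * stieltjesDenom u n j ∧ PowerSeries.constantCoeff (r + s) = 1 := by
  induction n generalizing j with
  | zero => exact ⟨1, 0, 0, 1, by simp [Matrix.one_fin_two], by simp [stieltjesDenom], by simp⟩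
  | succ n ih =>
    obtain ⟨p, q, r, s, h, hd, hc⟩ := ih (j + 1)
    have hinv := PowerSeries.mul_inv_cancel (stieltjesDenom u n (j + 1))
      (by simp [constantCoeff_stieltjesDenom])
    set v : K⟦X⟧ := PowerSeries.C (u j) * PowerSeries.X with hv
    refine ⟨p + v * r, q + v * s, p, q, ?_, ?_, ?_⟩
    · rw [List.range_succ_eq_map, List.map_cons, List.map_map, List.prod_cons]
      have e : ((fun i => stepMatrix (PowerSeries.C (u (j + i)) * PowerSeries.X)) ∘ Nat.succ :
          ℕ → Matrix (Fin 2) (Fin 2) K⟦X⟧) =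
          fun i => stepMatrix (PowerSeries.C (u (j + 1 + i)) * PowerSeries.X) := by
        funext i
        simp only [Function.comp_apply, Nat.succ_eq_add_one]
        rw [add_assoc, add_comm 1 i]
      rw [e, h, add_zero, ← hv, stepMatrix, Matrix.mul_fin_two]
      simp
    · rw [stieltjesDenom, ← hv]
      linear_combination (-(v * (stieltjesDenom u n (j + 1))⁻¹)) * hd -
        (r + s) * v * hinv
    · rw [hd, map_mul, hc, constantCoeff_stieltjesDenom, one_mul]

theorem X_pow_dvd_stieltjesDenom_sub (u : ℕ → K) (n : ℕ) :
    (PowerSeries.X : K⟦X⟧) ^ (n + 2) ∣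
      stieltjesDenom u (n + 1) 0 - (1 + PowerSeries.X * stieltjes u) := by
  have h : (PowerSeries.X : K⟦X⟧) ^ (n + 1) ∣ stieltjesFinite u n - stieltjes u := by
    rw [PowerSeries.X_pow_dvd_iff]
    intro d hd
    rw [map_sub, coeff_stieltjesFinite u (by omega), sub_self]
  obtain ⟨v, hv⟩ := h
  refine ⟨v, ?_⟩
  have e : stieltjesDenom u (n + 1) 0 = 1 + PowerSeries.X * stieltjesFinite u n := by
    rw [stieltjesDenom, stieltjesFinite]
    ring
  rw [e]
  linear_combination PowerSeries.X * hv

theorem map_thueMorseWord_eq {α β : Type*} [DecidableEq α] (a b : α) (f : α → β) (n : ℕ) :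
    (thueMorseWord a b n).map f = (List.range (2 ^ n)).map fun i => f (thueMorse a b i) := by
  apply List.ext_getElem?
  intro i
  rcases lt_or_ge i (2 ^ n) with hi | hi
  · simp [thueMorseWord_getElem? a b n i hi, hi]
  · rw [List.getElem?_eq_none (by simpa [thueMorseWord_length] using hi),
      List.getElem?_eq_none (by simpa using hi)]

theorem X_pow_dvd_stieltjes_thueMorse [DecidableEq K] (h2 : (2 : K⟦X⟧) = 0) {a : K} (ha1 : a ≠ 1)
    {A X t τ : K⟦X⟧} (hA : A = PowerSeries.C a) (hX : X = PowerSeries.X)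
    (ht : t = 1 + (A + 1) * X) (hτ : t * τ = 1) (m : ℕ) :
    ∃ g, X ^ (m + 1) ∣ X * (stieltjes (thueMorse a 1) + A) - (g + τ * g ^ 2) ∧
      X ^ (m + 1) ∣ τ ^ 2 * g ^ 4 + g + A * X ^ 2 := by
  obtain ⟨r, p, s, g, hs, hM, -, hr, hdet, hg⟩ := exists_substMatrix_eq ha1.symm h2 ht hτ
    (fun c => stepMatrix (PowerSeries.C c * PowerSeries.X)) (by rw [hA, hX]) (by simp [hX]) m
  refine ⟨g, ?_, hg⟩
  -- The word has `n + 1` letters `u_0, …, u_n`; starting at index 0, its continued fraction is `1 +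
  -- x · Stiel_n`.
  obtain ⟨n, hn⟩ : ∃ n, 2 ^ (2 * m + 1) = n + 1 :=
    ⟨_, (Nat.succ_pred_eq_of_pos (by positivity)).symm⟩
  have hmn : m + 1 ≤ n + 2 := by
    have := (2 * m + 1).lt_two_pow_self
    omega
  obtain ⟨p', q', r', s', hM', hd, hc⟩ := stieltjesDenom_eq_prod_stepMatrix (thueMorse a 1) (n + 1) 0
  have hMM : !![p', q'; r', s'] = !![r, p; s, r + t * s] := by
    rw [← hM', ← hM, ← add_zero (2 * m + 1), ← prod_map_thueMorseWord, map_thueMorseWord_eq, hn]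
    simp [substMatrix]
  have e1 : p' = r := congrFun (congrFun hMM 0) 0
  have e2 : q' = p := congrFun (congrFun hMM 0) 1
  have e3 : r' = s := congrFun (congrFun hMM 1) 0
  have e4 : s' = r + t * s := congrFun (congrFun hMM 1) 1
  rw [e1, e2, e3, e4] at hd
  rw [e3, e4] at hc
  have hX1 := (pow_dvd_pow X hmn).trans (hX ▸ X_pow_dvd_stieltjesDenom_sub (thueMorse a 1) n)
  set D := stieltjesDenom (thueMorse a 1) (n + 1) 0
  have hu : IsUnit (s + (r + t * s)) := by
    rw [PowerSeries.isUnit_iff_constantCoeff, hc]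
    exact isUnit_one
  have hX2 : X ^ (m + 1) ∣ D - (1 + A * X + g + τ * g ^ 2) := by
    -- `D - r/s` is the determinant over a unit, because `D` is the image of 1 under the matrix.
    have e : (D - (1 + A * X + g + τ * g ^ 2)) * (s * (s + (r + t * s))) =
        s ^ 2 * (τ ^ 2 * g ^ 4 + g + A * X ^ 2) := by
      rw [← hdet]
      linear_combination (s + (r + t * s)) * hr - s * hd - r * (r + t * s) * h2
    rw [← (hs.mul hu).dvd_mul_right, e]
    exact hg.mul_left _
  have := dvd_sub hX2 hX1
  have e : X * (stieltjes (thueMorse a 1) + A) - (g + τ * g ^ 2) =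
      D - (1 + A * X + g + τ * g ^ 2) - (D - (1 + X * stieltjes (thueMorse a 1))) +
        A * X * 2 := by ring
  rw [e, h2, mul_zero, add_zero]
  exact this

theorem quartic_relation_stieltjes_thueMorse [DecidableEq K] (h2 : (2 : K⟦X⟧) = 0) {a : K}
    (ha1 : a ≠ 1) {A X t H : K⟦X⟧} (hA : A = PowerSeries.C a) (hX : X = PowerSeries.X)
    (ht : t = 1 + (A + 1) * X) (hH : H = X * (stieltjes (thueMorse a 1) + A)) :
    H ^ 4 + t * H ^ 2 + (A + 1) * X * t * H + (A * X ^ 2) ^ 2 + (A + 1) * X * t * (A * X ^ 2) = 0 := by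
  obtain ⟨τ, hτ⟩ : ∃ τ, t * τ = 1 := by
    refine (PowerSeries.isUnit_iff_constantCoeff.2 ?_).exists_right_inv
    simp [ht, hX]
  suffices h : ∀ m, X ^ (m + 1) ∣ H ^ 4 + t * H ^ 2 + (A + 1) * X * t * H + (A * X ^ 2) ^ 2 +
      (A + 1) * X * t * (A * X ^ 2) by
    rw [hX] at h ⊢
    ext d
    rw [map_zero]
    exact PowerSeries.X_pow_dvd_iff.1 (h d) d d.lt_succ_self
  intro m
  obtain ⟨g, ⟨v, hv⟩, w, hw⟩ := X_pow_dvd_stieltjes_thueMorse h2 ha1 hA hX ht hτ m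
  rw [← hH] at hv
  set Y := X ^ (m + 1)
  have hc : (A + 1) * X = t - 1 := by rw [ht]; ring
  have hH' : H = g + τ * g ^ 2 + Y * v := by linear_combination hv
  rw [hc, hH']
  obtain ⟨d, hd⟩ : ∃ d, d = A * X ^ 2 := ⟨_, rfl⟩
  rw [← hd] at hw ⊢
  have key : (g + τ * g ^ 2) ^ 4 + t * (g + τ * g ^ 2) ^ 2 + (t - 1) * t * (g + τ * g ^ 2) + d ^ 2 +
      (t - 1) * t * d = Y * w * (Y * w + t + t ^ 2) := by
    rw [← hw]
    clear * - h2 hτ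
    grind
  -- The quartic's nonconstant part is additive in characteristic two: the first term comes from
  -- `key`, the others from the error `Y * v` in `H`.
  refine ⟨w * (Y * w + t + t ^ 2) + Y ^ 3 * v ^ 4 + t * Y * v ^ 2 + (t - 1) * t * v, ?_⟩
  generalize g + τ * g ^ 2 = G at key ⊢
  clear * - h2 key
  grind

end Convergents

/-! ### Irreducibility of the auxiliary quartic. -/

section Minpoly

variable {K : Type*} [Field K]

/-- The monic quartic `z ^ 4 + b * z + e` is Eisenstein at a prime `b` with `e = b * (β + b * c)`
and `b ∤ β`. -/
theorem irreducible_quartic_of_prime {R : Type*} [CommRing R] [IsDomain R] {b β c : R}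
    (hb : Prime b) (hβ : ¬ b ∣ β) :
    Irreducible (Polynomial.X ^ 4 + Polynomial.C b * Polynomial.X +
      Polynomial.C (b * (β + b * c)) : R[X]) := by
  set f : R[X] := Polynomial.X ^ 4 + Polynomial.C b * Polynomial.X +
      Polynomial.C (b * (β + b * c)) with hf
  have hdeg : f.natDegree = 4 := by rw [hf]; compute_degree!
  have hmonic : f.Monic := by rw [hf]; monicity!
  have hprime : (Ideal.span {b}).IsPrime := (Ideal.span_singleton_prime hb.ne_zero).2 hb
  refine (hmonic.isEisensteinAt_of_mem_of_notMem hprime.ne_top ?_ ?_).irreducible hprime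
    hmonic.isPrimitive (by omega)
  · intro n hn
    rw [hdeg] at hn
    rw [Ideal.mem_span_singleton]
    interval_cases n <;> simp [hf, Polynomial.coeff_X, Polynomial.coeff_C, Polynomial.coeff_X_pow]
  · rw [Ideal.span_singleton_pow, Ideal.mem_span_singleton]
    have e : f.coeff 0 = b * (β + b * c) := by
      simp [hf, Polynomial.coeff_X_pow]
    rw [e, sq, mul_dvd_mul_iff_left hb.ne_zero]
    intro h
    exact hβ ((dvd_add_left (dvd_mul_right b c)).1 h)

/-- Modulo `b = (a+1)X + 1` one has `X = 1/(a+1)`, so the equation becomes `w⁴ = β⁴`. The shift `w +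
β` therefore makes the quartic Eisenstein at `b`. -/
theorem natDegree_minpoly_eq_four (h2 : (2 : K) = 0) {L : Type*} [Field L] [Algebra (RatFunc K) L]
    {a β : K} (ha0 : a ≠ 0) (ha1 : a + 1 ≠ 0) (hβ : β ^ 2 = a / (a + 1) ^ 2) {A X w : L}
    (hA : A = algebraMap (RatFunc K) L (RatFunc.C a))
    (hX : X = algebraMap (RatFunc K) L RatFunc.X)
    (hw : w ^ 4 + (1 + (A + 1) * X) * w + (A * X ^ 2) ^ 2 = 0) :
    (minpoly (RatFunc K) w).natDegree = 4 := by
  set b : K[X] := Polynomial.C (a + 1) * Polynomial.X + Polynomial.C 1 with hb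
  have hbdeg : b.degree = 1 := Polynomial.degree_linear ha1
  have hbp : Prime b := (Polynomial.irreducible_of_degree_eq_one hbdeg).prime
  have hβ0 : β ≠ 0 := by
    rintro rfl
    have : a / (a + 1) ^ 2 ≠ 0 := by positivity
    exact this (by rw [← hβ]; ring)
  have hβb : ¬ b ∣ Polynomial.C β := by
    intro h
    have := Polynomial.degree_le_of_dvd h (Polynomial.C_ne_zero.2 hβ0)
    rw [hbdeg, Polynomial.degree_C hβ0] at this
    exact absurd this (by decide)
  -- Since `a²X⁴ = β⁴(b + 1)⁴ = β⁴b⁴ + β⁴`, the shifted constant term is `bβ + β⁴b⁴`.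
  have hirr := irreducible_quartic_of_prime (c := Polynomial.C (β ^ 4) * b ^ 2) hbp hβb
  set f : K[X][X] := Polynomial.X ^ 4 + Polynomial.C b * Polynomial.X +
      Polynomial.C (b * (Polynomial.C β + b * (Polynomial.C (β ^ 4) * b ^ 2))) with hf
  have hmonic : f.Monic := by rw [hf]; monicity!
  have hdeg : f.natDegree = 4 := by rw [hf]; compute_degree!
  have hirr' : Irreducible (f.map (algebraMap K[X] (RatFunc K))) :=
    (hmonic.irreducible_iff_irreducible_map_fraction_map).1 hirr
  set φ := algebraMap (RatFunc K) L with hφ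
  have h2L : (2 : L) = 0 := by
    have := congrArg (fun y => φ (RatFunc.C y)) h2
    simpa only [map_ofNat, map_zero] using this
  obtain ⟨B, hB⟩ : ∃ B, B = φ (RatFunc.C β) := ⟨_, rfl⟩
  have hBA : (B * (A + 1)) ^ 2 = A := by
    have h : (β * (a + 1)) ^ 2 = a := by
      rw [mul_pow, hβ]
      field_simp
    have := congrArg (fun y => φ (RatFunc.C y)) h
    simpa [hB, hA] using this
  have hroot : Polynomial.aeval (w + B) (f.map (algebraMap K[X] (RatFunc K))) = 0 := by
    have e : Polynomial.aeval (w + B) (f.map (algebraMap K[X] (RatFunc K))) =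
        (w + B) ^ 4 + ((A + 1) * X + 1) * (w + B) +
          ((A + 1) * X + 1) * (B + ((A + 1) * X + 1) * (B ^ 4 * ((A + 1) * X + 1) ^ 2)) := by
      simp [hf, hb, hA, hB, hX, ← hφ]
    rw [e]
    have h4 : B ^ 4 * (A + 1) ^ 4 = A ^ 2 := by
      linear_combination ((B * (A + 1)) ^ 2 + A) * hBA
    clear * - hw h2L h4
    generalize (A + 1) = c at *
    grind
  have hmin := minpoly.eq_of_irreducible_of_monic hirr' hroot (hmonic.map _)
  have := minpoly.add_algebraMap w (RatFunc.C β)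
  rw [← hφ, ← hB, ← hmin] at this
  have h := congrArg Polynomial.natDegree this
  rwa [hmonic.natDegree_map, hdeg, Polynomial.natDegree_comp, Polynomial.natDegree_X_sub_C,
    mul_one, eq_comm] at h

end Minpoly

/-! ### Degrees in simple extensions and identities over Laurent series. -/

theorem minpoly_natDegree_le_of_mem_adjoin {F L : Type*} [Field F] [Field L] [Algebra F L] {x y : L}
    (hx : IsIntegral F x) (hy : y ∈ IntermediateField.adjoin F {x}) :
    (minpoly F y).natDegree ≤ (minpoly F x).natDegree := by
  have := IntermediateField.adjoin.finiteDimensional hx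
  have h := minpoly.algebraMap_eq (A := F) (algebraMap (IntermediateField.adjoin F {x}) L).injective
    ⟨y, hy⟩
  rw [← IntermediateField.adjoin.finrank hx]
  exact (congrArg Polynomial.natDegree h).le.trans (minpoly.natDegree_le _)

theorem laurentSeries_coe_C_eq {K : Type*} [Field K] (a : K) :
    ((PowerSeries.C a : K⟦X⟧) : K⸨X⸩) = algebraMap (RatFunc K) K⸨X⸩ (RatFunc.C a) := by
  rw [← Polynomial.coe_C, RatFunc.coe_coe]
  exact congrArg _ (RatFunc.algebraMap_C a)

theorem laurentSeries_coe_X_eq {K : Type*} [Field K] :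
    ((PowerSeries.X : K⟦X⟧) : K⸨X⸩) = algebraMap (RatFunc K) K⸨X⸩ RatFunc.X := by
  rw [← Polynomial.coe_X, RatFunc.coe_coe]
  exact congrArg _ RatFunc.algebraMap_X

theorem quartic_identity_of_relation {L : Type*} [Field L] (h2 : (2 : L) = 0) {A X S : L} (hX : X ≠ 0)
    (h : (X * (S + A)) ^ 4 + (1 + (A + 1) * X) * (X * (S + A)) ^ 2 +
      (A + 1) * X * (1 + (A + 1) * X) * (X * (S + A)) + (A * X ^ 2) ^ 2 +
      (A + 1) * X * (1 + (A + 1) * X) * (A * X ^ 2) = 0) :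
    (A ^ 2 + 1) * (A ^ 2 + A) * X ^ 2 + A + (A + 1) * ((A + 1) * X + 1) * S +
      ((A + 1) * X + 1) * S ^ 2 + X ^ 2 * S ^ 4 = 0 := by
  apply (mul_eq_zero.1 _).resolve_left (pow_ne_zero 2 hX)
  clear hX
  rw [← h]
  grind

/-- Here `w` is `g²/t` with `g` eliminated: `g = H + w` and `g⁴ = t²(g + d)` give `w² = H + w + d`,
and squaring gives the quartic for `w`. -/
theorem quartic_relation_of_relation {L : Type*} [Field L] (h2 : (2 : L) = 0) {A X H w : L}
    (hAX : (A + 1) * X ≠ 0)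
    (h : H ^ 4 + (1 + (A + 1) * X) * H ^ 2 + (A + 1) * X * (1 + (A + 1) * X) * H + (A * X ^ 2) ^ 2 +
      (A + 1) * X * (1 + (A + 1) * X) * (A * X ^ 2) = 0)
    (hw : w = (H + H ^ 2 + A * X ^ 2) / ((A + 1) * X)) :
    w ^ 4 + (1 + (A + 1) * X) * w + (A * X ^ 2) ^ 2 = 0 := by
  rw [eq_div_iff hAX] at hw
  generalize (A + 1) * X = y at *
  generalize A * X ^ 2 = d at *
  have h1 : w ^ 2 = H + w + d := by
    apply mul_left_cancel₀ (pow_ne_zero 2 hAX)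
    clear hAX
    grind
  grind

/-! ### The minimal polynomial. -/

theorem mainTheorem6 {K : Type*} [Field K] [DecidableEq K] (k : ℕ)
    (hk : k = 2 ∨ k = 3 ∨ k = 4) (hK : Nat.card K = 2 ^ k) (a : K) (ha0 : a ≠ 0) (ha1 : a ≠ 1)
    (S : K⸨X⸩) (hS : S = ((stieltjes (thueMorse a 1) : K⟦X⟧) : K⸨X⸩))
    (p0 p1 p2 p4 : RatFunc K)
    (hp0 : p0 = RatFunc.C ((a ^ 2 + 1) / a ^ 4) * RatFunc.X ^ 2 + RatFunc.C (1 / (a ^ 5 + a ^ 4)))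
    (hp1 : p1 = RatFunc.C ((a + 1) / a ^ 5) * RatFunc.X + RatFunc.C (1 / a ^ 5))
    (hp2 : p2 = RatFunc.C (1 / a ^ 5) * RatFunc.X + RatFunc.C (1 / (a ^ 6 + a ^ 5)))
    (hp4 : p4 = RatFunc.C (1 / (a ^ 6 + a ^ 5)) * RatFunc.X ^ 2) :
    IsAlgebraic (RatFunc K) S ∧ p4 ≠ 0 ∧
      quarticPoly p0 p1 p2 p4 = Polynomial.C p4 * minpoly (RatFunc K) S := by
  have hfin : Finite K := Nat.finite_of_card_ne_zero (by rw [hK]; positivity)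
  have : Fintype K := Fintype.ofFinite K
  have hchar : CharP K 2 :=
    charP_of_card_eq_prime_pow (f := k) (by rw [← Nat.card_eq_fintype_card, hK])
  have h2 : (2 : K) = 0 := CharTwo.two_eq_zero
  have h2P : (2 : K⟦X⟧) = 0 := by
    rw [← map_ofNat (PowerSeries.C (R := K)) 2]
    simp [h2]
  have ha1' : a + 1 ≠ 0 := fun h => ha1 (by linear_combination h - h2)
  set φ := algebraMap (RatFunc K) K⸨X⸩ with hφ
  have h2L : (2 : K⸨X⸩) = 0 := by
    have := congrArg (fun y => φ (RatFunc.C y)) h2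
    simpa only [map_ofNat, map_zero] using this
  obtain ⟨β, hβ⟩ := FiniteField.isSquare_of_char_two (ringChar.eq K 2) (a / (a + 1) ^ 2)
  obtain ⟨A, hA⟩ : ∃ A, A = φ (RatFunc.C a) := ⟨_, rfl⟩
  obtain ⟨X, hX⟩ : ∃ X, X = φ RatFunc.X := ⟨_, rfl⟩
  have hX0 : X ≠ 0 := by rw [hX]; simpa using RatFunc.X_ne_zero
  have hA1 : A + 1 ≠ 0 := by
    rw [hA, ← map_one φ, ← map_one RatFunc.C, ← map_add, ← map_add]
    exact (map_ne_zero φ).2 ((map_ne_zero RatFunc.C).2 ha1')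
  have hrel : (X * (S + A)) ^ 4 + (1 + (A + 1) * X) * (X * (S + A)) ^ 2 +
      (A + 1) * X * (1 + (A + 1) * X) * (X * (S + A)) + (A * X ^ 2) ^ 2 +
      (A + 1) * X * (1 + (A + 1) * X) * (A * X ^ 2) = 0 := by
    have h := congrArg (HahnSeries.ofPowerSeries ℤ K)
      (quartic_relation_stieltjes_thueMorse h2P ha1 rfl rfl rfl rfl)
    simp only [map_add, map_mul, map_pow, map_one, map_zero, laurentSeries_coe_C_eq,
      laurentSeries_coe_X_eq, ← hφ, ← hA, ← hX, ← hS] at h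
    exact h
  have hpoly := quartic_identity_of_relation h2L hX0 hrel
  set w := (X * (S + A) + (X * (S + A)) ^ 2 + A * X ^ 2) / ((A + 1) * X) with hw
  have hdegw := natDegree_minpoly_eq_four h2 ha0 ha1' (by rw [hβ, sq]) hA hX
    (quartic_relation_of_relation h2L (mul_ne_zero hA1 hX0) hrel hw)
  have ha6 : a ^ 6 + a ^ 5 ≠ 0 := by
    rw [show a ^ 6 + a ^ 5 = a ^ 5 * (a + 1) by ring]
    positivity
  have ha5 : a ^ 5 + a ^ 4 ≠ 0 := by
    rw [show a ^ 5 + a ^ 4 = a ^ 4 * (a + 1) by ring]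
    positivity
  have hp40 : p4 ≠ 0 := by
    rw [hp4]
    exact mul_ne_zero ((map_ne_zero RatFunc.C).2 (one_div_ne_zero ha6)) (pow_ne_zero 2 RatFunc.X_ne_zero)
  have hq : quarticPoly p0 p1 p2 p4 = Polynomial.C p4 *
      (Polynomial.X ^ 4 + Polynomial.C (p2 / p4) * Polynomial.X ^ 2 +
        Polynomial.C (p1 / p4) * Polynomial.X + Polynomial.C (p0 / p4)) := by
    have e : ∀ p : RatFunc K, p = p4 * (p / p4) := fun p => by field_simp
    rw [quarticPoly]
    nth_rewrite 1 [e p0, e p1, e p2]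
    simp only [map_mul]
    ring
  have hroot : Polynomial.aeval S (quarticPoly p0 p1 p2 p4) = 0 := by
    -- Each `p_i` is the matching coefficient of `hpoly` divided by `a⁶ + a⁵`.
    have e0 : p0 = RatFunc.C (1 / (a ^ 6 + a ^ 5)) *
        ((RatFunc.C a ^ 2 + 1) * (RatFunc.C a ^ 2 + RatFunc.C a) * RatFunc.X ^ 2 + RatFunc.C a) := by
      have e1 : (a ^ 2 + 1) / a ^ 4 = 1 / (a ^ 6 + a ^ 5) * ((a ^ 2 + 1) * (a ^ 2 + a)) := by
        field_simp
      have e2 : 1 / (a ^ 5 + a ^ 4) = 1 / (a ^ 6 + a ^ 5) * a := by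
        field_simp
      rw [hp0, e1, e2]
      simp only [map_mul, map_add, map_pow, map_one]
      ring
    have e1 : p1 = RatFunc.C (1 / (a ^ 6 + a ^ 5)) *
        ((RatFunc.C a + 1) * ((RatFunc.C a + 1) * RatFunc.X + 1)) := by
      have e1 : (a + 1) / a ^ 5 = 1 / (a ^ 6 + a ^ 5) * ((a + 1) * (a + 1)) := by
        field_simp
      have e2 : 1 / a ^ 5 = 1 / (a ^ 6 + a ^ 5) * (a + 1) := by
        field_simp
      rw [hp1, e1, e2]
      simp only [map_mul, map_add, map_one]
      ring
    have e2 : p2 = RatFunc.C (1 / (a ^ 6 + a ^ 5)) * ((RatFunc.C a + 1) * RatFunc.X + 1) := by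
      have e2 : 1 / a ^ 5 = 1 / (a ^ 6 + a ^ 5) * (a + 1) := by
        field_simp
      rw [hp2, e2]
      simp only [map_mul, map_add, map_one]
      ring
    rw [quarticPoly, e0, e1, e2, hp4]
    simp only [map_mul, map_add, map_pow, map_one, Polynomial.aeval_C, Polynomial.aeval_X, ← hφ,
      ← hA, ← hX]
    linear_combination φ (RatFunc.C (1 / (a ^ 6 + a ^ 5))) * hpoly
  set Q : (RatFunc K)[X] := Polynomial.X ^ 4 + Polynomial.C (p2 / p4) * Polynomial.X ^ 2 +
        Polynomial.C (p1 / p4) * Polynomial.X + Polynomial.C (p0 / p4) with hQ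
  have hQm : Q.Monic := by rw [hQ]; monicity!
  have hQd : Q.natDegree = 4 := by rw [hQ]; compute_degree!
  have hQroot : Polynomial.aeval S Q = 0 := by
    rw [hq, map_mul, Polynomial.aeval_C] at hroot
    exact (mul_eq_zero.1 hroot).resolve_left (by simpa using hp40)
  have hint : IsIntegral (RatFunc K) S := ⟨Q, hQm, hQroot⟩
  refine ⟨hint.isAlgebraic, hp40, ?_⟩
  rw [hq]
  congr 1
  refine Polynomial.eq_of_monic_of_dvd_of_natDegree_le (minpoly.monic hint) hQm
    (minpoly.dvd _ _ hQroot) ?_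
  -- It remains to bound the degree of `S` below by that of `w`, which lies in the field generated
  -- by `S`.
  rw [hQd, ← hdegw]
  refine minpoly_natDegree_le_of_mem_adjoin hint ?_
  have hmem : ∀ y : RatFunc K, φ y ∈ IntermediateField.adjoin (RatFunc K) {S} :=
    fun y => IntermediateField.algebraMap_mem _ y
  have hSm : S ∈ IntermediateField.adjoin (RatFunc K) {S} :=
    IntermediateField.mem_adjoin_simple_self _ S
  have hAm := hA ▸ hmem (RatFunc.C a)
  have hXm := hX ▸ hmem RatFunc.X
  have hHm := mul_mem hXm (add_mem hSm hAm)
  exact div_mem (add_mem (add_mem hHm (pow_mem hHm 2)) (mul_mem hAm (pow_mem hXm 2)))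
    (mul_mem (add_mem hAm (one_mem _)) hXm)
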